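/- A rotation $R \in \mathrm{SO}(2)$ is called \emph{generic} if it is not a coincidence rotation of the square lattice $\mathbb{Z}^2$, that is, if $R \notin \mathrm{SO}(2,\mathbb{Q})$. For a locally finite set $M \subset \mathbb{R}^2$ write $\delta_M = \sum_{x \in M} \delta_x$. The autocorrelation $\gamma_\omega$ of a locally finite positive measure $\omega$ on $\mathbb{R}^2$ is the limit, if it exists, \[ \gamma_\omega = \lim_{r \to \infty} \frac{1}{\pi r^2}\, \omega_r * \widetilde{\omega_r} \] in the vague topology (tested against continuous functions of compact support), where $\omega_r$ is the restriction of $\omega$ to the closed disc of radius $r$ around $0$ and $\widetilde{\omega_r}$ is the image of $\omega_r$ under $x \mapsto -x$. The diffraction measure of $\omega$ is the Fourier transform $\widehat{\gamma}_\omega$ in the sense of tempered distributions, with $\widehat{g}(k) = \int_{\mathbb{R}^2} e^{-2\pi i k \cdot x} g(x)\, dx$ for Schwartz functions $g$. \textbf{Lemma.} Let $R \in \mathrm{SO}(2)$ be a generic rotation. Then $\mathbb{Z}^2 \cap R\mathbb{Z}^2 = \{0\}$, and the autocorrelation of $\omega = \frac{1}{2} ( \delta_{\mathbb{Z}^2}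 + \delta_{R\mathbb{Z}^2} )$ exists and is \[ \gamma_\omega = \tfrac{1}{4}\, \delta_{\mathbb{Z}^2} + \tfrac{1}{4}\, \delta_{R\mathbb{Z}^2} + \tfrac{1}{2}\, \lambda , \] where $\lambda$ is the Lebesgue measure on $\mathbb{R}^2$. The diffraction measure of $\omega$ is \[ \widehat{\gamma}_\omega = \sum_{x \in \mathbb{Z}^2 \cup R\mathbb{Z}^2} I(x)\, \delta_x , \] with $I(0) = 1$ and $I(x) = \frac{1}{4}$ for all $0 \neq x \in \mathbb{Z}^2 \cup R\mathbb{Z}^2$. -/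

import Mathlib

open MeasureTheory Filter Topology Metric
open scoped ENNReal FourierTransform SchwartzMap CompactlySupported

noncomputable section

namespace PlaneDiffraction

/-- The Euclidean plane. -/
abbrev Plane : Type := EuclideanSpace ℝ (Fin 2)

/-- The square lattice `ℤ²`. -/
def squareLattice : Set Plane := {x | ∀ i, ∃ n : ℤ, x i = n}

/-- The image `R ℤ²` of the square lattice under a matrix `R`. -/
def imageLattice (R : Matrix (Fin 2) (Fin 2) ℝ) : Set Plane :=
  Matrix.toEuclideanLin R '' squareLattice

/-- `SO(2, ℚ)`, as a set of real matrices. -/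
def rationalRotations : Set (Matrix (Fin 2) (Fin 2) ℝ) :=
  {R | ∃ Q ∈ Matrix.specialOrthogonalGroup (Fin 2) ℚ, R = Q.map (fun q : ℚ => (q : ℝ))}

/-- A generic rotation: an element of `SO(2)` that is not a coincidence rotation of the square
lattice, i.e. that does not lie in `SO(2, ℚ)`. -/
def IsGenericRotation (R : Matrix (Fin 2) (Fin 2) ℝ) : Prop :=
  R ∈ Matrix.specialOrthogonalGroup (Fin 2) ℝ ∧ R ∉ rationalRotations

/-- The Dirac comb `∑_{x ∈ M} I(x) δ_x` with weights `I`. -/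
def weightedComb (M : Set Plane) (I : Plane → ℝ≥0∞) : Measure Plane :=
  Measure.sum fun x : M => I x • Measure.dirac (x : Plane)

/-- The Dirac comb `δ_M = ∑_{x ∈ M} δ_x`. -/
def diracComb (M : Set Plane) : Measure Plane :=
  Measure.sum fun x : M => Measure.dirac (x : Plane)

/-- `vol(B_r)⁻¹ · (ω_r ∗ ω̃_r)`, where `ω_r` is the restriction of `ω` to the closed ball of radius
`r` around the origin and `ω̃_r` is its image under `x ↦ -x`. -/
def ballAutocorrelation (ω : Measure Plane) (r : ℝ) : Measure Plane :=
  (volume (closedBall (0 : Plane) r))⁻¹ •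
    ((ω.restrict (closedBall 0 r)).conv ((ω.restrict (closedBall 0 r)).map fun x => -x))

/-- The measure `γ` is the autocorrelation of the positive measure `ω`: the limit of
`vol(B_r)⁻¹ · (ω_r ∗ ω̃_r)` as `r → ∞` in the vague topology, i.e. tested against continuous functions
of compact support. -/
structure IsAutocorrelation (ω γ : Measure Plane) : Prop where
  locallyFinite_left : IsLocallyFiniteMeasure ω
  locallyFinite_right : IsLocallyFiniteMeasure γ
  tendsto (f : C_c(Plane, ℂ)) :
    Tendsto (fun r : ℝ => ∫ x, f x ∂(ballAutocorrelation ω r)) atTop (𝓝 (∫ x, f x ∂γ))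

/-- The positive measure `ν` is the Fourier transform of the positive measure `μ` in the sense of
tempered distributions (the transform of a function being `∫ e^{-2πi k·x} g(x) dx`). -/
def IsFourierTransform (μ ν : Measure Plane) : Prop :=
  ∃ (_ : μ.HasTemperateGrowth) (_ : ν.HasTemperateGrowth),
    𝓕 μ.toTemperedDistribution = ν.toTemperedDistribution

/-- The measure `ν` is the diffraction measure of `ω`: the Fourier transform of its
autocorrelation. -/
def IsDiffraction (ω ν : Measure Plane) : Prop :=
  ∃ γ : Measure Plane, IsAutocorrelation ω γ ∧ IsFourierTransform γ ν

end PlaneDiffraction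

end

open PlaneDiffraction

/-! Genericity enters in one way: `R k` is not an integer vector for any nonzero integer vector `k`
(`IsGenericRotation.exists_ne_intCast`). This is the trivial intersection of the lattices, and also
Weyl's criterion for the points of `ℤ²` modulo `R ℤ²`.

The autocorrelation splits into four averages of `f` over differences of lattice points in a large
disc. Up to a boundary error of smaller order than the area, the inner sum is a periodization of `f`
(`tendsto_sum_sum_sub_sum_periodization`). For pairs from one lattice the periodization is constant
along the points and gives the comb. For mixed pairs the points equidistribute on the torus
(`tendsto_average_toTorus`), so the average tends to the zeroth Fourier coefficient, which is `∫ f`.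
The two mixed terms, each with weight 1/4, give half of Lebesgue measure.

Poisson summation makes both combs self-dual, since `R` is orthogonal, and Lebesgue measure
transforms to `δ₀`. The origin thus gets intensity 1/4 + 1/4 + 1/2 = 1, every other point 1/4. -/

namespace PlaneDiffraction

/-! ### Integer vectors and functions of cubic decay -/

/-- The point of the square lattice with given integer coordinates. -/
def intVec : (Fin 2 → ℤ) →+ Plane where
  toFun n := WithLp.toLp 2 fun i => (n i : ℝ)
  map_zero' := by ext; simp
  map_add' m n := by ext; simp

@[simp]
lemma intVec_apply (n : Fin 2 → ℤ) (i : Fin 2) : intVec n i = n i := rfl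

lemma intVec_injective : Function.Injective intVec := fun m n h => by
  ext i
  have := congrArg (fun x : Plane => x i) h
  simpa using this

lemma range_intVec : Set.range intVec = squareLattice := by
  ext x
  constructor
  · rintro ⟨n, rfl⟩ i
    exact ⟨n i, rfl⟩
  · intro h
    choose n hn using h
    exact ⟨n, by ext i; simp [hn]⟩

lemma norm_le_norm_intVec (n : Fin 2 → ℤ) : ‖n‖ ≤ ‖intVec n‖ := by
  refine (pi_norm_le_iff_of_nonneg (norm_nonneg _)).2 fun i => ?_
  have := PiLp.norm_apply_le (intVec n) i
  rwa [intVec_apply, Real.norm_eq_abs, ← Int.cast_abs, Int.abs_eq_natAbs, Int.cast_natCast,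
    ← Int.norm_natCast, ← Int.abs_eq_natAbs, Int.norm_eq_abs, Int.cast_abs, abs_abs,
    ← Int.norm_eq_abs] at this

/-- The decaying weight `(1 + ‖x‖)⁻³`. -/
noncomputable def weight (x : Plane) : ℝ := ((1 + ‖x‖) ^ 3)⁻¹

lemma weight_nonneg (x : Plane) : 0 ≤ weight x := by
  unfold weight
  positivity

lemma rpow_eq_weight (x : Plane) : (1 + ‖x‖) ^ (-((3 : ℕ) : ℝ)) = weight x := by
  rw [Real.rpow_neg (by positivity), Real.rpow_natCast, weight]

/-- The exponent 3 exceeds the dimension 2, which gives integrability here and summability over `ℤ²`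
below. Schwartz and compactly supported continuous functions are both dominated by this weight, so
one class of functions serves Poisson summation and vague convergence alike. -/
lemma integrable_weight : Integrable weight := by
  have h := integrable_one_add_norm (E := Plane) (μ := volume) (r := ((3 : ℕ) : ℝ))
    (by simp; norm_num)
  simpa only [rpow_eq_weight] using h

lemma summable_weight : Summable fun n => weight (intVec n) := by
  refine Summable.of_norm_bounded_eventually
    (EisensteinSeries.summable_one_div_norm_rpow (k := ((3 : ℕ) : ℝ)) (by norm_num)) ?_
  -- The origin is excluded because the real power with negative exponent is 0 there by convention,
  -- while the weight is 1.
  have : {0}ᶜ ∈ (cofinite : Filter (Fin 2 → ℤ)) := (Set.finite_singleton 0).compl_mem_cofinite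
  filter_upwards [this] with n hn
  have hn' : 0 < ‖n‖ := norm_pos_iff.2 hn
  rw [Real.norm_of_nonneg (weight_nonneg _), weight, Real.rpow_neg (by positivity),
    Real.rpow_natCast]
  have := norm_le_norm_intVec n
  gcongr
  linarith

lemma weight_add_le {t : Plane} {ρ : ℝ} (ht : ‖t‖ ≤ ρ) (x : Plane) :
    weight (t + x) ≤ (1 + ρ) ^ 3 * weight x := by
  have h1 : ‖x‖ ≤ ‖t + x‖ + ‖t‖ := by
    simpa using norm_sub_le (t + x) t
  have h0 := norm_nonneg t
  have h2 : 1 + ‖x‖ ≤ (1 + ρ) * (1 + ‖t + x‖) := by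
    nlinarith [norm_nonneg (t + x)]
  have h3 : (1 + ‖x‖) ^ 3 ≤ (1 + ρ) ^ 3 * (1 + ‖t + x‖) ^ 3 := by
    rw [← mul_pow]; gcongr
  unfold weight
  rw [← div_eq_mul_inv, le_div_iff₀ (by positivity), ← div_eq_inv_mul, div_le_iff₀ (by positivity)]
  exact h3

/-- A continuous function on the plane that is bounded by a multiple of `(1 + ‖x‖)⁻³`. -/
structure HasDecay (f : Plane → ℂ) : Prop where
  continuous : Continuous f
  bound : ∃ C, ∀ x, ‖f x‖ ≤ C * weight x

namespace HasDecay

variable {f : Plane → ℂ}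

/-- Uniformity in bounded `t` is what yields locally uniform convergence of the periodization. -/
lemma bound_add (hf : HasDecay f) (ρ : ℝ) :
    ∃ C, ∀ t x, ‖t‖ ≤ ρ → ‖f (t + x)‖ ≤ C * weight x := by
  obtain ⟨C, hC⟩ := hf.bound
  have hC0 : 0 ≤ C := by
    have := (norm_nonneg _).trans (hC 0)
    simpa [weight] using this
  refine ⟨C * (1 + ρ) ^ 3, fun t x ht => (hC _).trans ?_⟩
  rw [mul_assoc]
  exact mul_le_mul_of_nonneg_left (weight_add_le ht x) hC0

lemma integrable (hf : HasDecay f) : Integrable f := by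
  obtain ⟨C, hC⟩ := hf.bound
  exact (integrable_weight.const_mul C).mono' hf.continuous.aestronglyMeasurable
    (Eventually.of_forall hC)

lemma summable_norm (hf : HasDecay f) (t : Plane) : Summable fun n => ‖f (t + intVec n)‖ := by
  obtain ⟨C, hC⟩ := hf.bound_add ‖t‖
  exact Summable.of_nonneg_of_le (fun _ => norm_nonneg _) (fun n => hC t _ le_rfl)
    (summable_weight.mul_left C)

lemma summable (hf : HasDecay f) (t : Plane) : Summable fun n => f (t + intVec n) :=
  (hf.summable_norm t).of_norm

lemma summable_intVec (hf : HasDecay f) : Summable fun n => f (intVec n) := by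
  simpa using hf.summable 0

lemma comp (hf : HasDecay f) (A : Plane ≃ₗᵢ[ℝ] Plane) : HasDecay fun x => f (A x) := by
  obtain ⟨C, hC⟩ := hf.bound
  exact ⟨hf.continuous.comp A.continuous, C, fun x => by simpa [weight] using hC (A x)⟩

lemma norm (hf : HasDecay f) : HasDecay fun x => (‖f x‖ : ℂ) := by
  obtain ⟨C, hC⟩ := hf.bound
  refine ⟨?_, C, fun x => by simpa using hC x⟩
  have := hf.continuous
  fun_prop

lemma continuous_tsum (hf : HasDecay f) : Continuous fun t => ∑' n, f (t + intVec n) := by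
  refine continuous_iff_continuousAt.2 fun t => ?_
  have ho : ball (0 : Plane) (‖t‖ + 1) ∈ 𝓝 t := isOpen_ball.mem_nhds (by simp)
  refine ContinuousOn.continuousAt ?_ ho
  obtain ⟨C, hC⟩ := hf.bound_add (‖t‖ + 1)
  refine continuousOn_tsum (u := fun n => C * weight (intVec n)) (fun n => ?_)
    (summable_weight.mul_left C) (fun n x hx => hC x _ (mem_ball_zero_iff.1 hx).le)
  exact (hf.continuous.comp (continuous_id.add continuous_const)).continuousOn

end HasDecay

lemma _root_.SchwartzMap.hasDecay (g : 𝓢(Plane, ℂ)) : HasDecay g := by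
  refine ⟨g.continuous, ?_⟩
  obtain ⟨C, hC⟩ : ∃ C, ∀ x, (1 + ‖x‖) ^ 3 * ‖g x‖ ≤ C := by
    refine ⟨2 ^ 3 * ((Finset.Iic (3, 0)).sup fun m => SchwartzMap.seminorm ℂ m.1 m.2) g,
      fun x => ?_⟩
    have := SchwartzMap.one_add_le_sup_seminorm_apply (𝕜 := ℂ) (m := (3, 0)) (k := 3) (n := 0)
      le_rfl le_rfl g x
    rwa [norm_iteratedFDeriv_zero] at this
  refine ⟨C, fun x => ?_⟩
  rw [weight, ← div_eq_mul_inv, le_div_iff₀ (by positivity), mul_comm]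
  exact hC x

lemma HasDecay.of_hasCompactSupport {f : Plane → ℂ} (hf : Continuous f)
    (hc : HasCompactSupport f) : HasDecay f := by
  refine ⟨hf, ?_⟩
  have h2 : HasCompactSupport fun x => ((1 + ‖x‖) ^ 3 : ℝ) • f x :=
    hc.mono fun x hx h => hx (by simp [h])
  obtain ⟨C, hC⟩ := Continuous.bounded_above_of_compact_support (by fun_prop) h2
  refine ⟨C, fun x => ?_⟩
  rw [weight, ← div_eq_mul_inv, le_div_iff₀ (by positivity), mul_comm]
  have := hC x
  rwa [norm_smul, Real.norm_of_nonneg (by positivity)] at this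

/-! ### Periodization on the torus and Poisson summation -/

/-- The quotient map from the plane to the torus `ℝ² / ℤ²`. -/
def toTorus : C(Plane, UnitAddTorus (Fin 2)) where
  toFun x i := (x i : UnitAddCircle)
  continuous_toFun := continuous_pi fun i =>
    (AddCircle.continuous_mk' 1).comp (PiLp.continuous_apply 2 _ i)

lemma toTorus_apply (x : Plane) (i : Fin 2) : toTorus x i = (x i : UnitAddCircle) := rfl

lemma isQuotientMap_toTorus : IsQuotientMap toTorus := by
  have h1 : IsOpenQuotientMap (Pi.map fun (_ : Fin 2) (x : ℝ) => (x : UnitAddCircle)) :=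
    IsOpenQuotientMap.piMap fun _ => QuotientAddGroup.isOpenQuotientMap_mk
  exact h1.isQuotientMap.comp (PiLp.homeomorph 2 fun _ : Fin 2 => ℝ).isQuotientMap

lemma exists_intVec_of_toTorus_eq {x y : Plane} (h : toTorus x = toTorus y) :
    ∃ n, y = x + intVec n := by
  have h' : ∀ i, ∃ n : ℤ, y i = x i + n := fun i => by
    have := congrFun h i
    simp only [toTorus_apply] at this
    obtain ⟨n, hn⟩ : -x i + y i ∈ AddSubgroup.zmultiples (1 : ℝ) := QuotientAddGroup.eq.1 this
    refine ⟨n, ?_⟩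
    simp at hn
    linarith
  choose n hn using h'
  exact ⟨n, by ext i; simp [hn]⟩

lemma mFourier_toTorus (k : Fin 2 → ℤ) (x : Plane) :
    UnitAddTorus.mFourier k (toTorus x) = (𝐞 (inner ℝ x (intVec k)) : ℂ) := by
  simp only [UnitAddTorus.mFourier, ContinuousMap.coe_mk, toTorus_apply, Fin.prod_univ_two,
    fourier_coe_apply, Real.fourierChar_apply, PiLp.inner_apply, Fin.sum_univ_two, intVec_apply,
    ← Complex.exp_add]
  congr 1
  simp
  ring

/-- The half-open unit square with lower left corner `n`. -/
def unitBox (n : Fin 2 → ℤ) : Set Plane := {x | ∀ i, x i ∈ Set.Ioc (n i : ℝ) (n i + 1)}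

/-- Being open on the left and closed on the right, the boxes are the fibres of the coordinatewise
ceiling; disjointness, covering and translation reduce to integer identities. -/
lemma mem_unitBox {n : Fin 2 → ℤ} {x : Plane} : x ∈ unitBox n ↔ ∀ i, ⌈x i⌉ = n i + 1 := by
  refine forall_congr' fun i => ?_
  rw [Int.ceil_eq_iff]
  simp

lemma measurableSet_unitBox (n : Fin 2 → ℤ) : MeasurableSet (unitBox n) := by
  simp only [unitBox, Set.ofPred_forall]
  refine MeasurableSet.iInter fun i => measurableSet_Ioc.preimage ?_
  exact (PiLp.continuous_apply 2 _ i).measurable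

lemma pairwise_disjoint_unitBox : Pairwise (Function.onFun Disjoint unitBox) := by
  refine fun m n hmn => Set.disjoint_left.2 fun x hm hn => hmn ?_
  rw [mem_unitBox] at hm hn
  ext i
  have := hm i
  have := hn i
  omega

lemma iUnion_unitBox : ⋃ n, unitBox n = Set.univ := by
  refine Set.eq_univ_of_forall fun x => Set.mem_iUnion.2 ⟨fun i => ⌈x i⌉ - 1, ?_⟩
  rw [mem_unitBox]
  simp

lemma preimage_add_intVec_unitBox (n : Fin 2 → ℤ) :
    (fun x => x + intVec n) ⁻¹' unitBox n = unitBox 0 := by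
  ext x
  simp [mem_unitBox, add_comm]

lemma norm_le_of_mem_unitBox {x : Plane} (hx : x ∈ unitBox 0) : ‖x‖ ≤ 2 := by
  have h0 := hx 0
  have h1 := hx 1
  simp only [Pi.zero_apply, Int.cast_zero, zero_add, Set.mem_Ioc] at h0 h1
  rw [EuclideanSpace.norm_eq, Real.sqrt_le_left (by norm_num)]
  simp only [Fin.sum_univ_two, Real.norm_eq_abs, sq_abs]
  nlinarith

lemma volume_unitBox_lt_top : volume (unitBox 0) < ∞ :=
  (measure_mono fun _ hx => mem_closedBall_zero_iff.2 (norm_le_of_mem_unitBox hx)).trans_lt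
    measure_closedBall_lt_top

lemma hasSum_setIntegral_unitBox {g : Plane → ℂ} (hg : Integrable g) :
    HasSum (fun n => ∫ x in unitBox 0, g (x + intVec n)) (∫ x, g x) := by
  have h := hasSum_integral_iUnion measurableSet_unitBox pairwise_disjoint_unitBox
    (hg.integrableOn (s := ⋃ n, unitBox n))
  rw [iUnion_unitBox, setIntegral_univ] at h
  refine h.congr_fun fun n => ?_
  rw [← preimage_add_intVec_unitBox n]
  exact (measurePreserving_add_right volume (intVec n)).setIntegral_preimage_emb
    (measurableEmbedding_addRight _) g _

lemma mFourierCoeff_eq_setIntegral_unitBox (F : UnitAddTorus (Fin 2) → ℂ) (k : Fin 2 → ℤ) :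
    UnitAddTorus.mFourierCoeff F k =
      ∫ x in unitBox 0, UnitAddTorus.mFourier (-k) (toTorus x) * F (toTorus x) := by
  rw [UnitAddTorus.mFourierCoeff_eq_integral F k 0]
  rw [← (PiLp.volume_preserving_ofLp (Fin 2)).setIntegral_preimage_emb
    (MeasurableEquiv.toLp 2 (Fin 2 → ℝ)).symm.measurableEmbedding]
  congr 2
  ext x
  simp [unitBox]

namespace HasDecay

variable {f : Plane → ℂ}

lemma factorsThrough_toTorus (hf : HasDecay f) :
    Function.FactorsThrough (⟨_, hf.continuous_tsum⟩ : C(Plane, ℂ)) toTorus := fun x y hxy => by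
  obtain ⟨m, rfl⟩ := exists_intVec_of_toTorus_eq hxy
  simp only [ContinuousMap.coe_mk]
  rw [← (Equiv.addLeft m).tsum_eq]
  simp [add_assoc]

/-- The periodization `∑ₙ f(· + n)` as a continuous function on the torus. -/
noncomputable def periodization (hf : HasDecay f) : C(UnitAddTorus (Fin 2), ℂ) :=
  isQuotientMap_toTorus.lift ⟨_, hf.continuous_tsum⟩ hf.factorsThrough_toTorus

lemma periodization_toTorus (hf : HasDecay f) (x : Plane) :
    hf.periodization (toTorus x) = ∑' n, f (x + intVec n) :=
  ContinuousMap.congr_fun (isQuotientMap_toTorus.lift_comp ⟨_, hf.continuous_tsum⟩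
    hf.factorsThrough_toTorus) x

/-- Unfolding: a character of the torus is invariant under integer translations, so integrating it
against the periodization over one box is integrating it against `f` over the plane. -/
lemma mFourierCoeff_periodization (hf : HasDecay f) (k : Fin 2 → ℤ) :
    UnitAddTorus.mFourierCoeff hf.periodization k = 𝓕 f (intVec k) := by
  set g : Plane → ℂ := fun x => UnitAddTorus.mFourier (-k) (toTorus x) * f x with hg
  have hnorm : ∀ x, ‖g x‖ = ‖f x‖ := fun x => by
    rw [hg]
    simp only [norm_mul, mFourier_toTorus, Circle.norm_coe, one_mul]
  have hper : ∀ x n, g (x + intVec n) =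
      UnitAddTorus.mFourier (-k) (toTorus x) * f (x + intVec n) := fun x n => by
    have : toTorus (x + intVec n) = toTorus x := by
      ext i
      simp only [toTorus_apply, PiLp.add_apply, intVec_apply, AddCircle.coe_add]
      have : ((n i : ℝ) : UnitAddCircle) = 0 :=
        (AddCircle.coe_eq_zero_iff 1).2 ⟨n i, by simp⟩
      rw [this, add_zero]
    simp only [hg, this]
  have hgc : Continuous g :=
    ((map_continuous _).comp isQuotientMap_toTorus.continuous).mul hf.continuous
  have hgi : Integrable g :=
    hf.integrable.congr' hgc.aestronglyMeasurable (Eventually.of_forall fun x => (hnorm x).symm)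
  obtain ⟨C, hC⟩ := hf.bound_add 2
  have hF : ∀ n, Integrable (fun x => g (x + intVec n)) (volume.restrict (unitBox 0)) :=
    fun n => (hgi.comp_add_right (intVec n)).integrableOn
  -- On the bounded box the translates of `f` are dominated by a summable multiple of `weight
  -- (intVec n)`, which justifies exchanging sum and integral.
  have hS : Summable fun n => ∫ x in unitBox 0, ‖g (x + intVec n)‖ := by
    refine Summable.of_nonneg_of_le (fun n => integral_nonneg fun _ => norm_nonneg _)
      (fun n => ?_) (summable_weight.mul_left (volume.real (unitBox 0) * C))
    rw [mul_assoc, ← smul_eq_mul, ← setIntegral_const]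
    refine setIntegral_mono_on (hF n).norm
      (integrableOn_const volume_unitBox_lt_top.ne) (measurableSet_unitBox 0) fun x hx => ?_
    rw [hnorm]
    exact hC _ _ (norm_le_of_mem_unitBox hx)
  have h1 := hasSum_integral_of_summable_integral_norm hF hS
  rw [mFourierCoeff_eq_setIntegral_unitBox]
  simp_rw [hf.periodization_toTorus, ← tsum_mul_left, ← hper]
  rw [h1.unique (hasSum_setIntegral_unitBox hgi), Real.fourier_eq]
  congr 1 with x
  rw [hg]
  simp only [mFourier_toTorus, map_neg, inner_neg_right, Circle.smul_def, smul_eq_mul]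

end HasDecay

/-- The Poisson summation formula for the square lattice. -/
theorem tsum_intVec_fourier (g : 𝓢(Plane, ℂ)) :
    ∑' n, 𝓕 g (intVec n) = ∑' n, g (intVec n) := by
  -- The coefficients are lattice values of the Schwartz function `𝓕 g`. Summability makes the
  -- Fourier series converge pointwise, and its value at the origin is the formula.
  have hs : Summable (UnitAddTorus.mFourierCoeff g.hasDecay.periodization) := by
    refine (𝓕 g).hasDecay.summable_intVec.congr fun n => ?_
    rw [g.hasDecay.mFourierCoeff_periodization, SchwartzMap.fourier_coe]
  have h := UnitAddTorus.hasSum_mFourier_series_apply_of_summable hs (toTorus 0)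
  simp_rw [g.hasDecay.mFourierCoeff_periodization, g.hasDecay.periodization_toTorus,
    mFourier_toTorus] at h
  simpa [SchwartzMap.fourier_coe] using h.tsum_eq

/-- The Poisson summation formula for the image of the square lattice under an isometry. -/
theorem tsum_isometry_fourier (A : Plane ≃ₗᵢ[ℝ] Plane) (g : 𝓢(Plane, ℂ)) :
    ∑' n, 𝓕 g (A (intVec n)) = ∑' n, g (A (intVec n)) := by
  have h := tsum_intVec_fourier
    (SchwartzMap.compCLMOfContinuousLinearEquiv ℂ A.toContinuousLinearEquiv g)
  simp only [SchwartzMap.fourier_coe, SchwartzMap.compCLMOfContinuousLinearEquiv_apply] at h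
  have h2 : ∀ x, 𝓕 (⇑g ∘ ⇑A.toContinuousLinearEquiv) x = 𝓕 (⇑g) (A x) :=
    fun x => Real.fourier_comp_linearIsometry A g x
  simp only [h2] at h
  simpa [SchwartzMap.fourier_coe] using h

/-! ### Counting lattice points in discs -/

lemma finite_setOf_norm_intVec_le (r : ℝ) : {n | ‖intVec n‖ ≤ r}.Finite :=
  (isCompact_closedBall (0 : Fin 2 → ℤ) r).finite_of_discrete.subset fun n hn =>
    mem_closedBall_zero_iff.2 ((norm_le_norm_intVec n).trans hn)

/-- The integer vectors of Euclidean norm at most `r`. -/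
noncomputable def latticeBall (r : ℝ) : Finset (Fin 2 → ℤ) :=
  (finite_setOf_norm_intVec_le r).toFinset

@[simp]
lemma mem_latticeBall {r : ℝ} {n : Fin 2 → ℤ} : n ∈ latticeBall r ↔ ‖intVec n‖ ≤ r := by
  simp [latticeBall]

lemma latticeBall_mono {r s : ℝ} (h : r ≤ s) : latticeBall r ⊆ latticeBall s := fun n hn => by
  rw [mem_latticeBall] at *
  exact hn.trans h

/-- The area of the disc of radius `r`. -/
noncomputable def discArea (r : ℝ) : ℝ := volume.real (closedBall (0 : Plane) r)

lemma discArea_nonneg (r : ℝ) : 0 ≤ discArea r := measureReal_nonneg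

lemma discArea_eq {r : ℝ} (hr : 0 ≤ r) : discArea r = r ^ 2 * Real.pi := by
  rw [discArea, measureReal_def, EuclideanSpace.volume_closedBall_fin_two, ENNReal.toReal_mul,
    ENNReal.toReal_pow, ENNReal.toReal_ofReal hr, ENNReal.toReal_ofReal Real.pi_pos.le]

open scoped Pointwise in
lemma card_inter_smul_span {r : ℝ} (hr : 0 < r) :
    Nat.card ↑((WithLp.ofLp '' closedBall (0 : Plane) 1) ∩
      r⁻¹ • (Submodule.span ℤ (Set.range (Pi.basisFun ℝ (Fin 2))) : Set (Fin 2 → ℝ))) =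
    (latticeBall r).card := by
  have hinj : Function.Injective fun n : Fin 2 → ℤ => r⁻¹ • (intVec n).ofLp := fun m n h =>
    intVec_injective (WithLp.ofLp_injective 2 (smul_right_injective _ (inv_ne_zero hr.ne') h))
  rw [Nat.card_coe_set_eq, ← Set.ncard_coe_finset, ← Set.ncard_image_of_injective _ hinj]
  congr 1
  ext x
  simp only [Set.mem_inter_iff, Set.mem_image, mem_closedBall_zero_iff, Set.mem_smul_set,
    SetLike.mem_coe, mem_latticeBall, Module.Basis.mem_span_iff_repr_mem, Pi.basisFun_repr]
  constructor
  · rintro ⟨⟨p, hp, rfl⟩, y, hy, hyp⟩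
    choose n hn using hy
    have hny : (intVec n).ofLp = y := by
      ext i
      simpa using hn i
    refine ⟨n, ?_, by rw [hny, hyp]⟩
    have : intVec n = r • p := by
      ext i
      rw [hny, WithLp.ofLp_smul, ← hyp, smul_inv_smul₀ hr.ne']
    rw [this, norm_smul, Real.norm_of_nonneg hr.le]
    nlinarith
  · rintro ⟨n, hn, rfl⟩
    refine ⟨⟨r⁻¹ • intVec n, ?_, rfl⟩, _, fun i => ⟨n i, by simp⟩, rfl⟩
    rw [norm_smul, norm_inv, Real.norm_of_nonneg hr.le, inv_mul_le_iff₀ hr]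
    simpa using hn

theorem tendsto_card_latticeBall_div_discArea :
    Tendsto (fun r => ((latticeBall r).card : ℝ) / discArea r) atTop (𝓝 1) := by
  set s : Set (Fin 2 → ℝ) := WithLp.ofLp '' closedBall (0 : Plane) 1 with hs
  let e := PiLp.continuousLinearEquiv 2 ℝ fun _ : Fin 2 => ℝ
  have hse : s = e '' closedBall (0 : Plane) 1 := rfl
  have hcompact : IsCompact s := (isCompact_closedBall (0 : Plane) 1).image e.continuous
  have hconvex : Convex ℝ s := (convex_closedBall (0 : Plane) 1).linear_image e.toLinearMap
  have h0 : (0 : Fin 2 → ℝ) ∈ s := ⟨0, by simp, rfl⟩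
  have hvol : volume.real s = Real.pi := by
    have h1 : WithLp.ofLp ⁻¹' s = closedBall (0 : Plane) 1 :=
      Set.preimage_image_eq _ (WithLp.ofLp_injective 2)
    have h2 := discArea_eq zero_le_one
    rw [discArea, ← h1] at h2
    rw [measureReal_def, ← (PiLp.volume_preserving_ofLp (Fin 2)).measure_preimage
      hcompact.measurableSet.nullMeasurableSet, ← measureReal_def, h2]
    simp
  -- The last argument asks that the dilates of the disc increase with the factor; this follows from
  -- convexity and `0 ∈ s`.
  have h := tendsto_card_div_pow_atTop_volume' s hcompact.isBounded hcompact.measurableSet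
    (hconvex.addHaar_frontier volume) fun x y hx hxy z hz => by
      obtain ⟨w, hw, rfl⟩ := hz
      refine ⟨(x / y) • w, ?_, ?_⟩
      · exact hconvex.smul_mem_of_zero_mem h0 hw
          ⟨div_nonneg hx.le (hx.le.trans hxy), div_le_one_of_le₀ hxy (hx.le.trans hxy)⟩
      · simp only [smul_smul]
        rw [mul_div_cancel₀ _ (hx.trans_le hxy).ne']
  rw [hvol] at h
  have h' := h.div_const Real.pi
  rw [div_self Real.pi_ne_zero] at h'
  refine h'.congr' ?_
  filter_upwards [eventually_gt_atTop 0] with r hr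
  rw [hs, card_inter_smul_span hr, discArea_eq hr.le, div_div, Fintype.card_fin]

/-- Boundary effects are negligible: both counts are asymptotic to areas, and discs of radii `r` and
`r - C` have asymptotically equal area. -/
theorem tendsto_card_annulus_div_discArea (C : ℝ) :
    Tendsto (fun r => (((latticeBall r).card : ℝ) - (latticeBall (r - C)).card) / discArea r)
      atTop (𝓝 0) := by
  have hsub : Tendsto (fun r : ℝ => r - C) atTop atTop :=
    tendsto_atTop_add_const_right _ (-C) tendsto_id
  have h1 := tendsto_card_latticeBall_div_discArea.comp hsub
  have h2 : Tendsto (fun r : ℝ => discArea (r - C) / discArea r) atTop (𝓝 1) := by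
    have h3 : Tendsto (fun r : ℝ => (1 - C * r⁻¹) ^ 2) atTop (𝓝 1) := by
      simpa using ((tendsto_inv_atTop_zero.const_mul C).const_sub 1).pow 2
    refine h3.congr' ?_
    filter_upwards [eventually_gt_atTop 0, eventually_ge_atTop C] with r hr hC
    rw [discArea_eq hr.le, discArea_eq (sub_nonneg.2 hC)]
    have := Real.pi_ne_zero
    field_simp
  have h4 := tendsto_card_latticeBall_div_discArea.sub (h1.mul h2)
  rw [mul_one, sub_self] at h4
  refine h4.congr' ?_
  filter_upwards [eventually_gt_atTop 0, eventually_gt_atTop C] with r hr hC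
  have h5 : discArea (r - C) ≠ 0 := by
    rw [discArea_eq (sub_nonneg.2 hC.le)]
    exact mul_ne_zero (pow_ne_zero _ (sub_pos.2 hC).ne') Real.pi_ne_zero
  simp only [Function.comp_apply]
  rw [div_mul_div_cancel₀ h5, sub_div]

lemma norm_sum_latticeBall_sub_le {C : ℝ} (hC : 0 ≤ C) {M : ℝ} {u : (Fin 2 → ℤ) → ℂ} (r : ℝ)
    (h0 : ∀ m, ‖intVec m‖ ≤ r - C → u m = 0) (hM : ∀ m, ‖intVec m‖ ≤ r → ‖u m‖ ≤ M) :
    ‖∑ m ∈ latticeBall r, u m‖ ≤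
      M * (((latticeBall r).card : ℝ) - (latticeBall (r - C)).card) := by
  have hsub : latticeBall (r - C) ⊆ latticeBall r := latticeBall_mono (by linarith)
  have hcard : ((latticeBall r \ latticeBall (r - C)).card : ℝ) =
      (latticeBall r).card - (latticeBall (r - C)).card := by
    rw [Finset.card_sdiff_of_subset hsub, Nat.cast_sub (Finset.card_le_card hsub)]
  rw [← Finset.sum_sdiff hsub, Finset.sum_eq_zero (s := latticeBall (r - C))
    fun m hm => h0 m (mem_latticeBall.1 hm), add_zero, ← hcard, mul_comm, ← nsmul_eq_mul]
  refine norm_sum_le_of_le _ (fun m hm => hM m ?_) |>.trans (by simp)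
  exact mem_latticeBall.1 (Finset.mem_sdiff.1 hm).1

/-! ### Exponential sums over discs -/

lemma norm_intVec_single (i : Fin 2) : ‖intVec (Pi.single i 1)‖ = 1 := by
  have : intVec (Pi.single i 1) = EuclideanSpace.single i (1 : ℝ) := by
    ext j
    by_cases h : j = i
    · subst h; simp
    · simp [h]
  rw [this, PiLp.norm_single, norm_one]

lemma inner_intVec_single (y : Plane) (i : Fin 2) :
    inner ℝ (intVec (Pi.single i 1)) y = y i := by
  rw [PiLp.inner_apply, Finset.sum_eq_single i]
  · simp
  · intro j _ hj
    simp [hj]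
  · simp

lemma fourierChar_ne_one {a : ℝ} (ha : ∀ n : ℤ, a ≠ n) : (𝐞 a : ℂ) ≠ 1 := by
  rw [Real.fourierChar_apply, Ne, Complex.exp_eq_one_iff]
  rintro ⟨n, hn⟩
  refine ha n ?_
  have h2 : (2 * Real.pi * Complex.I : ℂ) ≠ 0 := Complex.two_pi_I_ne_zero
  have h3 : (2 * Real.pi * Complex.I : ℂ) * a = (2 * Real.pi * Complex.I) * n := by
    push_cast at hn
    linear_combination hn
  exact_mod_cast mul_left_cancel₀ h2 h3

/-- Exponential sums over the lattice points in large discs are negligible if the frequency is not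
an integer vector. -/
theorem tendsto_sum_fourierChar_div_discArea {y : Plane} {i : Fin 2} (hy : ∀ n : ℤ, y i ≠ n) :
    Tendsto (fun r => (∑ m ∈ latticeBall r, (𝐞 (inner ℝ (intVec m) y) : ℂ)) / discArea r)
      atTop (𝓝 0) := by
  classical
  set e : Fin 2 → ℤ := Pi.single i 1 with he
  set u : (Fin 2 → ℤ) → ℂ := fun m => (𝐞 (inner ℝ (intVec m) y) : ℂ) with hu
  set c : ℂ := (𝐞 (y i) : ℂ) with hc
  have hnu : ∀ m, ‖u m‖ ≤ 1 := fun m => (Circle.norm_coe _).le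
  have hshift : ∀ m, u (m + e) = c * u m := fun m => by
    simp only [hu, hc, map_add, inner_add_left, he, inner_intVec_single, AddChar.map_add_eq_mul,
      Circle.coe_mul, mul_comm]
  have hne : ‖intVec e‖ = 1 := norm_intVec_single i
  have hc1 : 0 < ‖c - 1‖ := norm_pos_iff.2 (sub_ne_zero.2 (fourierChar_ne_one hy))
  -- Translation by `e` multiplies the summand by `c ≠ 1`, so `c - 1` times the sum is a difference
  -- of a shifted and an unshifted sum. Their common part cancels by `hT`; each of the two
  -- remainders lives on the annulus of width 2, hence the factor 2.
  have key : ∀ r, ‖c - 1‖ * ‖∑ m ∈ latticeBall r, u m‖ ≤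
      2 * (((latticeBall r).card : ℝ) - (latticeBall (r - 2)).card) := fun r => by
    have hT : ∑ m ∈ latticeBall r, (if m - e ∈ latticeBall (r - 1) then u m else 0) =
        ∑ m ∈ latticeBall r, (if m ∈ latticeBall (r - 1) then u (m + e) else 0) := by
      rw [← Finset.sum_filter, ← Finset.sum_filter]
      refine Finset.sum_nbij' (· - e) (· + e) ?_ ?_ ?_ ?_ ?_
      · intro m hm
        rw [Finset.mem_filter] at hm ⊢
        exact ⟨latticeBall_mono (by linarith) hm.2, hm.2⟩
      · intro m hm
        rw [Finset.mem_filter, mem_latticeBall, mem_latticeBall] at hm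
        rw [Finset.mem_filter, add_sub_cancel_right, mem_latticeBall, mem_latticeBall, map_add]
        exact ⟨(norm_add_le _ _).trans (by linarith), hm.2⟩
      all_goals simp
    have h1 := norm_sum_latticeBall_sub_le (C := 2) (by norm_num) (M := 1)
      (u := fun m => if m - e ∈ latticeBall (r - 1) then 0 else u m) r
      (fun m hm => if_pos (by
        rw [mem_latticeBall, map_sub]
        exact (norm_sub_le _ _).trans (by linarith)))
      (fun m _ => by split_ifs <;> simp [hnu m])
    have h2 := norm_sum_latticeBall_sub_le (C := 2) (by norm_num) (M := 1)
      (u := fun m => if m ∈ latticeBall (r - 1) then 0 else u (m + e)) r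
      (fun m hm => if_pos (by rw [mem_latticeBall]; linarith))
      (fun m _ => by split_ifs <;> simp [hnu (m + e)])
    have h3 : (c - 1) * ∑ m ∈ latticeBall r, u m =
        (∑ m ∈ latticeBall r, if m ∈ latticeBall (r - 1) then 0 else u (m + e)) -
          ∑ m ∈ latticeBall r, if m - e ∈ latticeBall (r - 1) then 0 else u m := by
      have h4 : ∀ (p : (Fin 2 → ℤ) → Prop) [DecidablePred p] (v : (Fin 2 → ℤ) → ℂ),
          (∑ m ∈ latticeBall r, if p m then 0 else v m) =
            ∑ m ∈ latticeBall r, v m - ∑ m ∈ latticeBall r, if p m then v m else 0 := by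
        intro p _ v
        rw [← Finset.sum_sub_distrib]
        exact Finset.sum_congr rfl fun m _ => by split_ifs <;> simp
      rw [h4, h4, hT, sub_mul, Finset.mul_sum]
      simp only [hshift]
      ring
    rw [← norm_mul, h3]
    exact (norm_sub_le _ _).trans (by linarith)
  have h := (tendsto_card_annulus_div_discArea 2).const_mul (2 / ‖c - 1‖)
  rw [mul_zero] at h
  refine squeeze_zero_norm (fun r => ?_) h
  rw [norm_div, Complex.norm_real, Real.norm_of_nonneg (discArea_nonneg r), ← mul_div_assoc]
  refine div_le_div_of_nonneg_right ?_ (discArea_nonneg r)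
  rw [div_mul_eq_mul_div, le_div_iff₀ hc1, mul_comm]
  exact key r

/-! ### Weyl equidistribution -/

lemma mFourierCoeff_zero_eq (F : UnitAddTorus (Fin 2) → ℂ) :
    UnitAddTorus.mFourierCoeff F 0 = ∫ x in unitBox 0, F (toTorus x) := by
  rw [mFourierCoeff_eq_setIntegral_unitBox, neg_zero, UnitAddTorus.mFourier_zero]
  simp

lemma mFourierCoeff_mFourier (k : Fin 2 → ℤ) :
    UnitAddTorus.mFourierCoeff (UnitAddTorus.mFourier k) 0 = if k = 0 then 1 else 0 := by
  classical
  rw [← UnitAddTorus.mFourierCoeff_toLp, ← UnitAddTorus.mFourierBasis_repr]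
  have h := congrFun (UnitAddTorus.coe_mFourierBasis (d := Fin 2)) k
  rw [← UnitAddTorus.mFourierLp, ← h, HilbertBasis.repr_self, lp.single_apply]
  simp [Pi.single_apply, eq_comm]

lemma integrableOn_unitBox_comp_toTorus (F : C(UnitAddTorus (Fin 2), ℂ)) :
    IntegrableOn (fun x => F (toTorus x)) (unitBox 0) := by
  refine Measure.integrableOn_of_bounded volume_unitBox_lt_top.ne
    (F.comp toTorus).continuous.aestronglyMeasurable
    (M := ‖F‖) (Eventually.of_forall fun x => F.norm_coe_le_norm _)

lemma norm_sum_latticeBall_le (F : C(UnitAddTorus (Fin 2), ℂ)) 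
    (v : (Fin 2 → ℤ) → UnitAddTorus (Fin 2)) (r : ℝ) :
    ‖(∑ m ∈ latticeBall r, F (v m)) / discArea r‖ ≤
      ‖F‖ * ((latticeBall r).card / discArea r) := by
  rw [norm_div, Complex.norm_real, Real.norm_of_nonneg (discArea_nonneg r), ← mul_div_assoc]
  refine div_le_div_of_nonneg_right ?_ (discArea_nonneg r)
  refine (norm_sum_le_of_le _ fun m _ => F.norm_coe_le_norm (v m)).trans ?_
  simp [mul_comm]

/-- Weyl equidistribution of the square lattice modulo a generically rotated square lattice. -/
theorem tendsto_average_toTorus {A : Plane ≃ₗᵢ[ℝ] Plane}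
    (hA : ∀ k ≠ 0, ∃ i, ∀ n : ℤ, A (intVec k) i ≠ n) (F : C(UnitAddTorus (Fin 2), ℂ)) :
    Tendsto (fun r => (∑ m ∈ latticeBall r, F (toTorus (A.symm (intVec m)))) / discArea r) atTop
      (𝓝 (UnitAddTorus.mFourierCoeff F 0)) := by
  set v : (Fin 2 → ℤ) → UnitAddTorus (Fin 2) := fun m => toTorus (A.symm (intVec m)) with hv
  have hspan : ∀ G ∈ Submodule.span ℂ (Set.range (UnitAddTorus.mFourier (d := Fin 2))),
      Tendsto (fun r => (∑ m ∈ latticeBall r, G (v m)) / discArea r) atTop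
        (𝓝 (UnitAddTorus.mFourierCoeff G 0)) := by
    intro G hG
    induction hG using Submodule.span_induction with
    | mem G hG =>
      obtain ⟨k, rfl⟩ := hG
      rw [mFourierCoeff_mFourier]
      split_ifs with hk
      · subst hk
        have h := (Complex.continuous_ofReal.tendsto 1).comp
          tendsto_card_latticeBall_div_discArea
        refine (h.congr fun r => ?_)
        simp [UnitAddTorus.mFourier_zero]
      · obtain ⟨i, hi⟩ := hA k hk
        refine (tendsto_sum_fourierChar_div_discArea hi).congr fun r => ?_
        congr 1
        refine Finset.sum_congr rfl fun m _ => ?_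
        -- Orthogonality moves `A` to the frequency: the character `k` at `A⁻¹ m` is the exponential
        -- with frequency `A k`, which is not integral.
        rw [hv, mFourier_toTorus, ← A.inner_map_map (A.symm _), A.apply_symm_apply]
    | zero =>
      rw [mFourierCoeff_zero_eq]
      simp
    | add G H _ _ hG hH =>
      have h := hG.add hH
      rw [mFourierCoeff_zero_eq, mFourierCoeff_zero_eq, ← integral_add
        (integrableOn_unitBox_comp_toTorus G) (integrableOn_unitBox_comp_toTorus H)] at h
      rw [mFourierCoeff_zero_eq]
      refine h.congr fun r => ?_
      simp only [ContinuousMap.add_apply, Finset.sum_add_distrib, add_div]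
    | smul a G _ hG =>
      have h := hG.const_mul a
      rw [mFourierCoeff_zero_eq, ← integral_const_mul] at h
      rw [mFourierCoeff_zero_eq]
      refine h.congr fun r => ?_
      simp only [ContinuousMap.smul_apply, smul_eq_mul, ← Finset.mul_sum, mul_div_assoc]
  set K := volume.real (unitBox 0) with hK
  have hK0 : 0 ≤ K := measureReal_nonneg
  refine Metric.tendsto_nhds.2 fun ε hε => ?_
  have hF : F ∈ (Submodule.span ℂ
      (Set.range (UnitAddTorus.mFourier (d := Fin 2)))).topologicalClosure := by
    rw [UnitAddTorus.span_mFourier_closure_eq_top]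
    trivial
  -- Replacing `F` by `G` costs at most `2 * ‖F - G‖` in the average, once the point count is at
  -- most twice the area, and `K * ‖F - G‖` in the mean. Together this is below `ε / 2`.
  obtain ⟨G, hG, hFG⟩ := Metric.mem_closure_iff.1 hF (ε / (2 * (2 + K))) (by positivity)
  rw [dist_eq_norm] at hFG
  have hmean : ‖UnitAddTorus.mFourierCoeff G 0 - UnitAddTorus.mFourierCoeff F 0‖ ≤
      ‖F - G‖ * K := by
    rw [mFourierCoeff_zero_eq, mFourierCoeff_zero_eq, ← integral_sub
      (integrableOn_unitBox_comp_toTorus G) (integrableOn_unitBox_comp_toTorus F)]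
    refine norm_setIntegral_le_of_norm_le_const volume_unitBox_lt_top fun x _ => ?_
    rw [norm_sub_rev]
    exact (F - G).norm_coe_le_norm _
  filter_upwards [Metric.tendsto_nhds.1 (hspan G hG) (ε / 2) (by positivity),
    tendsto_card_latticeBall_div_discArea.eventually_le_const one_lt_two] with r h1 h2
  rw [dist_eq_norm] at h1 ⊢
  have h3 := norm_sum_latticeBall_le (F - G) v r
  have h4 : (∑ m ∈ latticeBall r, F (v m)) / (discArea r : ℂ) =
      (∑ m ∈ latticeBall r, (F - G) (v m)) / discArea r +
        (∑ m ∈ latticeBall r, G (v m)) / discArea r := by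
    simp [← add_div]
  have h5 : ‖F - G‖ * ((latticeBall r).card / discArea r) ≤ ‖F - G‖ * 2 := by gcongr
  have h6 : ‖F - G‖ * (2 + K) < ε / 2 := by
    calc ‖F - G‖ * (2 + K) < ε / (2 * (2 + K)) * (2 + K) := by gcongr
      _ = ε / 2 := by field_simp
  calc ‖(∑ m ∈ latticeBall r, F (v m)) / (discArea r : ℂ) - UnitAddTorus.mFourierCoeff F 0‖
      = ‖(∑ m ∈ latticeBall r, (F - G) (v m)) / (discArea r : ℂ) +
          ((∑ m ∈ latticeBall r, G (v m)) / discArea r - UnitAddTorus.mFourierCoeff G 0) +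
          (UnitAddTorus.mFourierCoeff G 0 - UnitAddTorus.mFourierCoeff F 0)‖ := by
        rw [h4]; congr 1; ring
    _ ≤ _ := norm_add₃_le
    _ < ε := by linarith

/-! ### Averages over pairs of lattice points -/

lemma HasDecay.exists_bound_tsum_norm {f : Plane → ℂ} (hf : HasDecay f) :
    ∃ M, ∀ x, ∑' n, ‖f (x + intVec n)‖ ≤ M := by
  refine ⟨‖hf.norm.periodization‖, fun x => ?_⟩
  have h := hf.norm.periodization.norm_coe_le_norm (toTorus x)
  rw [hf.norm.periodization_toTorus, ← Complex.ofReal_tsum, Complex.norm_real] at h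
  exact (le_abs_self _).trans h

lemma sum_latticeBall_sub_intVec (h : Plane → ℂ) (x : Plane) (r : ℝ) :
    ∑ n ∈ latticeBall r, h (x - intVec n) = ∑ n ∈ latticeBall r, h (x + intVec n) :=
  Finset.sum_nbij' (- ·) (- ·) (by simp) (by simp) (by simp) (by simp)
    (by simp [sub_eq_add_neg])

/-- The double sum of a compactly supported function over differences of lattice points in large
discs agrees asymptotically with the single sum of its periodization. -/
theorem tendsto_sum_sum_sub_sum_periodization (A : Plane ≃ₗᵢ[ℝ] Plane) {f : Plane → ℂ}
    (hc : HasCompactSupport f) (hf : HasDecay f) :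
    Tendsto (fun r => (∑ m ∈ latticeBall r, ∑ n ∈ latticeBall r, f (intVec m - A (intVec n))) /
        discArea r - (∑ m ∈ latticeBall r,
          (hf.comp A).periodization (toTorus (A.symm (intVec m)))) / discArea r)
      atTop (𝓝 0) := by
  obtain ⟨C, hC⟩ := hc.isCompact.isBounded.subset_closedBall (0 : Plane)
  have hC' : ∀ x, C < ‖x‖ → f x = 0 := fun x hx => by
    by_contra h
    have := mem_closedBall_zero_iff.1 (hC (subset_tsupport f h))
    linarith
  obtain ⟨M, hM⟩ := (hf.comp A).exists_bound_tsum_norm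
  set D := max C 0
  have key : ∀ r, ‖∑ m ∈ latticeBall r, (∑ n ∈ latticeBall r, f (intVec m - A (intVec n)) -
      (hf.comp A).periodization (toTorus (A.symm (intVec m))))‖ ≤
      (2 * M) * (((latticeBall r).card : ℝ) - (latticeBall (r - D)).card) := fun r => by
    have hsum : ∀ m, ∑ n ∈ latticeBall r, f (intVec m - A (intVec n)) =
        ∑ n ∈ latticeBall r, f (A (A.symm (intVec m) + intVec n)) := fun m => by
      rw [← sum_latticeBall_sub_intVec fun x => f (A x)]
      simp
    -- If `‖m‖ ≤ r - D`, every `n` that contributes to the full periodization already lies in the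
    -- disc, so the difference vanishes. For the other `m` it is at most `2 * M`.
    refine norm_sum_latticeBall_sub_le (le_max_right C 0) r (fun m hm => ?_) fun m _ => ?_
    · rw [hsum, (hf.comp A).periodization_toTorus, tsum_eq_sum, sub_self]
      intro n hn
      refine hC' _ ?_
      rw [mem_latticeBall, not_le] at hn
      rw [A.norm_map]
      have h1 := norm_sub_norm_le (intVec n) (-A.symm (intVec m))
      rw [sub_neg_eq_add, norm_neg, A.symm.norm_map, add_comm (intVec n)] at h1
      have := le_max_left C 0
      linarith
    · rw [hsum, (hf.comp A).periodization_toTorus]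
      have hs := (hf.comp A).summable_norm (A.symm (intVec m))
      have h1 := (norm_sum_le (latticeBall r) fun n => f (A (A.symm (intVec m) + intVec n))).trans
        (hs.sum_le_tsum _ fun _ _ => norm_nonneg _)
      have h2 := norm_tsum_le_tsum_norm hs
      have h3 := hM (A.symm (intVec m))
      exact (norm_sub_le _ _).trans (by linarith)
  have h := (tendsto_card_annulus_div_discArea D).const_mul (2 * M)
  rw [mul_zero] at h
  refine squeeze_zero_norm (fun r => ?_) h
  rw [← sub_div, ← Finset.sum_sub_distrib, norm_div, Complex.norm_real,
    Real.norm_of_nonneg (discArea_nonneg r), ← mul_div_assoc]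
  exact div_le_div_of_nonneg_right (key r) (discArea_nonneg r)

/-- The mixed correlations of the square lattice and a generically rotated copy average to the
Lebesgue integral. -/
theorem tendsto_sum_sum_of_generic {A : Plane ≃ₗᵢ[ℝ] Plane}
    (hA : ∀ k ≠ 0, ∃ i, ∀ n : ℤ, A (intVec k) i ≠ n) {f : Plane → ℂ} (hc : HasCompactSupport f)
    (hf : Continuous f) :
    Tendsto (fun r => (∑ m ∈ latticeBall r, ∑ n ∈ latticeBall r, f (intVec m - A (intVec n))) /
      discArea r) atTop (𝓝 (∫ x, f x)) := by
  have hd := HasDecay.of_hasCompactSupport hf hc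
  have h := (tendsto_sum_sum_sub_sum_periodization A hc hd).add
    (tendsto_average_toTorus hA (hd.comp A).periodization)
  simp only [sub_add_cancel, zero_add, (hd.comp A).mFourierCoeff_periodization] at h
  convert h using 2
  rw [Real.fourier_eq]
  simp only [map_zero, inner_zero_right, neg_zero, AddChar.map_zero_eq_one, one_smul]
  exact (A.measurePreserving.integral_comp A.toHomeomorph.measurableEmbedding f).symm

theorem tendsto_sum_sum_self {f : Plane → ℂ} (hc : HasCompactSupport f) (hf : Continuous f) :
    Tendsto (fun r => (∑ m ∈ latticeBall r, ∑ n ∈ latticeBall r, f (intVec m - intVec n)) /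
      discArea r) atTop (𝓝 (∑' n, f (intVec n))) := by
  have hd := HasDecay.of_hasCompactSupport hf hc
  set A := LinearIsometryEquiv.refl ℝ Plane
  have hper : ∀ m, (hd.comp A).periodization (toTorus (A.symm (intVec m))) =
      ∑' n, f (intVec n) := fun m => by
    rw [(hd.comp A).periodization_toTorus, ← (Equiv.addLeft m).tsum_eq fun n => f (intVec n)]
    simp only [Equiv.coe_addLeft, map_add]
    rfl
  have h1 := ((Complex.continuous_ofReal.tendsto 1).comp
    tendsto_card_latticeBall_div_discArea).mul_const (∑' n, f (intVec n))
  have h := (tendsto_sum_sum_sub_sum_periodization A hc hd).add (h1.congr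
    (f₂ := fun r => (∑ m ∈ latticeBall r,
      (hd.comp A).periodization (toTorus (A.symm (intVec m)))) / discArea r) fun r => by
    simp only [hper, Finset.sum_const, nsmul_eq_mul, Function.comp_apply]
    push_cast
    ring)
  simpa [A] using h

/-! ### Integration against Dirac combs -/

lemma hasTemperateGrowth_of_integrable_weight {μ : Measure Plane} (hμ : Integrable weight μ) :
    μ.HasTemperateGrowth :=
  ⟨⟨3, by simpa only [rpow_eq_weight] using hμ⟩⟩

lemma isLocallyFiniteMeasure_of_integrable_weight {μ : Measure Plane} (hμ : Integrable weight μ) :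
    IsLocallyFiniteMeasure μ := by
  refine ⟨fun x => ⟨closedBall 0 (‖x‖ + 1), closedBall_mem_nhds_of_mem (by simp), ?_⟩⟩
  have hpos : 0 < ((1 + (‖x‖ + 1)) ^ 3)⁻¹ := by positivity
  refine (measure_mono fun y hy => ?_).trans_lt (hμ.measure_norm_ge_lt_top hpos)
  rw [mem_closedBall_zero_iff] at hy
  change _ ≤ ‖weight y‖
  rw [Real.norm_of_nonneg (weight_nonneg y), weight]
  gcongr

lemma HasDecay.integrable_of_integrable_weight {f : Plane → ℂ} (hf : HasDecay f)
    {μ : Measure Plane} (hμ : Integrable weight μ) : Integrable f μ := by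
  obtain ⟨C, hC⟩ := hf.bound
  exact (hμ.const_mul C).mono' hf.continuous.aestronglyMeasurable (Eventually.of_forall hC)

/-- The Dirac comb of the image of the square lattice under an isometry, as a sum over the integer
vectors. -/
noncomputable def isometryComb (A : Plane ≃ₗᵢ[ℝ] Plane) : Measure Plane :=
  Measure.sum fun n => Measure.dirac (A (intVec n))

lemma diracComb_range {ι : Type*} {v : ι → Plane} (hv : Function.Injective v) :
    diracComb (Set.range v) = Measure.sum fun i => Measure.dirac (v i) := by
  ext s hs
  rw [diracComb, Measure.sum_apply _ hs, Measure.sum_apply _ hs,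
    ← (Equiv.ofInjective v hv).tsum_eq]
  rfl

lemma isometry_intVec_injective (A : Plane ≃ₗᵢ[ℝ] Plane) :
    Function.Injective fun n => A (intVec n) :=
  A.injective.comp intVec_injective

lemma measurableEmbedding_isometry_intVec (A : Plane ≃ₗᵢ[ℝ] Plane) :
    MeasurableEmbedding fun n => A (intVec n) :=
  ⟨isometry_intVec_injective A, measurable_of_countable _,
    fun {s} _ => (s.to_countable.image _).measurableSet⟩

/-- As a pushforward of counting measure, the comb turns integrability into summability over `ℤ²`.
-/
lemma isometryComb_eq_map (A : Plane ≃ₗᵢ[ℝ] Plane) :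
    isometryComb A = Measure.count.map fun n => A (intVec n) := by
  have hm : Measurable fun n => A (intVec n) := measurable_of_countable _
  rw [Measure.count, Measure.map_sum hm.aemeasurable]
  simp only [Measure.map_dirac' hm, isometryComb]

lemma integrable_weight_isometryComb (A : Plane ≃ₗᵢ[ℝ] Plane) :
    Integrable weight (isometryComb A) := by
  rw [isometryComb_eq_map, (measurableEmbedding_isometry_intVec A).integrable_map_iff,
    integrable_count_iff]
  refine summable_weight.congr fun n => ?_
  simp [weight, abs_of_nonneg, add_nonneg]

lemma HasDecay.integral_isometryComb {f : Plane → ℂ} (hf : HasDecay f)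
    (A : Plane ≃ₗᵢ[ℝ] Plane) : ∫ x, f x ∂(isometryComb A) = ∑' n, f (A (intVec n)) := by
  have h := hf.integrable_of_integrable_weight (integrable_weight_isometryComb A)
  rw [isometryComb_eq_map, (measurableEmbedding_isometry_intVec A).integrable_map_iff] at h
  rw [isometryComb_eq_map, (measurableEmbedding_isometry_intVec A).integral_map]
  exact (integral_countable h).trans (by simp)

lemma restrict_isometryComb (A : Plane ≃ₗᵢ[ℝ] Plane) (r : ℝ) :
    (isometryComb A).restrict (closedBall 0 r) =
      ∑ n ∈ latticeBall r, Measure.dirac (A (intVec n)) := by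
  ext s hs
  rw [Measure.restrict_apply hs, isometryComb,
    Measure.sum_apply _ (hs.inter measurableSet_closedBall), Measure.finsetSum_apply,
    tsum_eq_sum (s := latticeBall r)]
  · refine Finset.sum_congr rfl fun n hn => ?_
    rw [Measure.dirac_apply, Measure.dirac_apply]
    by_cases h : A (intVec n) ∈ s <;> simp_all
  · intro n hn
    rw [Measure.dirac_apply]
    simp_all

/-- The superposition of the square lattice comb and its image under an isometry, with weights
one half. -/
noncomputable def halfComb (A : Plane ≃ₗᵢ[ℝ] Plane) : Measure Plane :=
  (1 / 2 : ℝ≥0∞) • (isometryComb (LinearIsometryEquiv.refl ℝ Plane) + isometryComb A)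

lemma integrable_weight_halfComb (A : Plane ≃ₗᵢ[ℝ] Plane) : Integrable weight (halfComb A) :=
  ((integrable_weight_isometryComb _).add_measure (integrable_weight_isometryComb A)).smul_measure
    (by simp)

lemma integral_halfComb_restrict (A : Plane ≃ₗᵢ[ℝ] Plane) (r : ℝ) (g : Plane → ℂ) :
    ∫ x, g x ∂((halfComb A).restrict (closedBall 0 r)) =
      1 / 2 * (∑ n ∈ latticeBall r, g (intVec n) + ∑ n ∈ latticeBall r, g (A (intVec n))) := by
  have hi : ∀ x, Integrable g (Measure.dirac x) := fun x => integrable_dirac (by simp)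
  rw [halfComb, Measure.restrict_smul, Measure.restrict_add, restrict_isometryComb,
    restrict_isometryComb, integral_smul_measure, integral_add_measure
      (integrable_finsetSum_measure.2 fun _ _ => hi _)
      (integrable_finsetSum_measure.2 fun _ _ => hi _),
    integral_finsetSum_measure fun _ _ => hi _, integral_finsetSum_measure fun _ _ => hi _]
  simp [mul_add]

lemma integral_ballAutocorrelation_halfComb (A : Plane ≃ₗᵢ[ℝ] Plane) (r : ℝ) {f : Plane → ℂ}
    (hf : Continuous f) (hc : HasCompactSupport f) :
    ∫ x, f x ∂(ballAutocorrelation (halfComb A) r) =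
      1 / 4 * ((∑ m ∈ latticeBall r, ∑ n ∈ latticeBall r, f (intVec m - intVec n)) / discArea r +
        (∑ m ∈ latticeBall r, ∑ n ∈ latticeBall r, f (intVec m - A (intVec n))) / discArea r +
        (∑ m ∈ latticeBall r, ∑ n ∈ latticeBall r, f (A (intVec m) - intVec n)) / discArea r +
        (∑ m ∈ latticeBall r, ∑ n ∈ latticeBall r, f (A (intVec m) - A (intVec n))) /
          discArea r) := by
  have := isLocallyFiniteMeasure_of_integrable_weight (integrable_weight_halfComb A)
  have hfin : IsFiniteMeasure ((halfComb A).restrict (closedBall 0 r)) :=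
    ⟨by simpa using measure_closedBall_lt_top⟩
  rw [ballAutocorrelation, integral_smul_measure,
    integral_conv (hf.integrable_of_hasCompactSupport hc), ENNReal.toReal_inv,
    ← measureReal_def, ← discArea]
  have hneg : ∀ x, ∫ y, f (x + y) ∂(((halfComb A).restrict (closedBall 0 r)).map fun x => -x) =
      1 / 2 * (∑ n ∈ latticeBall r, f (x - intVec n) +
        ∑ n ∈ latticeBall r, f (x - A (intVec n))) := fun x => by
    refine ((MeasurableEquiv.neg Plane).measurableEmbedding.integral_map _).trans ?_
    refine (integral_halfComb_restrict A r fun y => f (x + -y)).trans ?_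
    simp only [sub_eq_add_neg]
  simp only [hneg]
  rw [integral_halfComb_restrict A r fun x => 1 / 2 * (∑ n ∈ latticeBall r, f (x - intVec n) +
        ∑ n ∈ latticeBall r, f (x - A (intVec n)))]
  simp only [← Finset.mul_sum, Finset.sum_add_distrib, Complex.real_smul]
  push_cast
  ring

/-! ### Autocorrelation and diffraction of the superposition -/

/-- The autocorrelation of the half-weighted superposition of the square lattice and a generically
rotated copy. -/
noncomputable def halfCombAutocorrelation (A : Plane ≃ₗᵢ[ℝ] Plane) : Measure Plane :=
  (1 / 4 : ℝ≥0∞) • isometryComb (LinearIsometryEquiv.refl ℝ Plane) +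
    (1 / 4 : ℝ≥0∞) • isometryComb A + (1 / 2 : ℝ≥0∞) • (volume : Measure Plane)

/-- The diffraction measure of the half-weighted superposition of the square lattice and a
generically rotated copy. -/
noncomputable def halfCombDiffraction (A : Plane ≃ₗᵢ[ℝ] Plane) : Measure Plane :=
  (1 / 4 : ℝ≥0∞) • isometryComb (LinearIsometryEquiv.refl ℝ Plane) +
    (1 / 4 : ℝ≥0∞) • isometryComb A + (1 / 2 : ℝ≥0∞) • Measure.dirac (0 : Plane)

lemma integrable_weight_quarterCombs_add (A : Plane ≃ₗᵢ[ℝ] Plane) {μ : Measure Plane}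
    (hμ : Integrable weight μ) :
    Integrable weight ((1 / 4 : ℝ≥0∞) • isometryComb (LinearIsometryEquiv.refl ℝ Plane) +
      (1 / 4 : ℝ≥0∞) • isometryComb A + (1 / 2 : ℝ≥0∞) • μ) :=
  (((integrable_weight_isometryComb _).smul_measure (by simp)).add_measure
    ((integrable_weight_isometryComb A).smul_measure (by simp))).add_measure
    (hμ.smul_measure (by simp))

lemma HasDecay.integral_quarterCombs_add {f : Plane → ℂ} (hf : HasDecay f)
    (A : Plane ≃ₗᵢ[ℝ] Plane) {μ : Measure Plane} (hμ : Integrable weight μ) :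
    ∫ x, f x ∂((1 / 4 : ℝ≥0∞) • isometryComb (LinearIsometryEquiv.refl ℝ Plane) +
      (1 / 4 : ℝ≥0∞) • isometryComb A + (1 / 2 : ℝ≥0∞) • μ) =
      1 / 4 * ∑' n, f (intVec n) + 1 / 4 * ∑' n, f (A (intVec n)) + 1 / 2 * ∫ x, f x ∂μ := by
  have h1 := hf.integrable_of_integrable_weight
    ((integrable_weight_isometryComb (LinearIsometryEquiv.refl ℝ Plane)).smul_measure
      (c := 1 / 4) (by simp))
  have h2 := hf.integrable_of_integrable_weight
    ((integrable_weight_isometryComb A).smul_measure (c := 1 / 4) (by simp))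
  have h3 := hf.integrable_of_integrable_weight (hμ.smul_measure (c := 1 / 2) (by simp))
  rw [integral_add_measure (h1.add_measure h2) h3, integral_add_measure h1 h2,
    integral_smul_measure, integral_smul_measure, integral_smul_measure, hf.integral_isometryComb,
    hf.integral_isometryComb]
  simp

lemma integrable_weight_dirac : Integrable weight (Measure.dirac (0 : Plane)) :=
  integrable_dirac (by simp)

theorem isAutocorrelation_halfComb {A : Plane ≃ₗᵢ[ℝ] Plane}
    (hA : ∀ k ≠ 0, ∃ i, ∀ n : ℤ, A (intVec k) i ≠ n) :
    IsAutocorrelation (halfComb A) (halfCombAutocorrelation A) := by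
  refine ⟨isLocallyFiniteMeasure_of_integrable_weight (integrable_weight_halfComb A),
    isLocallyFiniteMeasure_of_integrable_weight
      (integrable_weight_quarterCombs_add A integrable_weight), fun f => ?_⟩
  have hf : Continuous f := f.continuous
  have hc : HasCompactSupport f := f.hasCompactSupport
  have hneg : HasCompactSupport fun x => f (-x) := hc.comp_homeomorph (Homeomorph.neg Plane)
  have hrot : HasCompactSupport fun x => f (A x) := hc.comp_homeomorph A.toHomeomorph
  have h11 := tendsto_sum_sum_self hc hf
  have h1A := tendsto_sum_sum_of_generic hA hc hf
  -- The second mixed term is the first one for the reflected test function, with the two sums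
  -- exchanged; the last term is the unrotated one for `f ∘ A`.
  have hA1 := tendsto_sum_sum_of_generic hA hneg (hf.comp continuous_neg)
  have hAA := tendsto_sum_sum_self hrot (hf.comp A.continuous)
  simp only [neg_sub, integral_neg_eq_self fun x => f x] at hA1
  rw [halfCombAutocorrelation, (HasDecay.of_hasCompactSupport hf hc).integral_quarterCombs_add A
    integrable_weight]
  have h := (((h11.add h1A).add hA1).add hAA).const_mul (1 / 4)
  have hlim : 1 / 4 * ∑' n, f (intVec n) + 1 / 4 * ∑' n, f (A (intVec n)) + 1 / 2 * ∫ x, f x =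
      1 / 4 * (∑' n, f (intVec n) + (∫ x, f x) + (∫ x, f x) + ∑' n, f (A (intVec n))) := by ring
  rw [hlim]
  refine h.congr fun r => ?_
  rw [integral_ballAutocorrelation_halfComb A r hf hc]
  congr 3
  · rw [Finset.sum_comm]
  · simp only [map_sub]

theorem isFourierTransform_halfCombAutocorrelation (A : Plane ≃ₗᵢ[ℝ] Plane) :
    IsFourierTransform (halfCombAutocorrelation A) (halfCombDiffraction A) := by
  have hγ : Integrable weight (halfCombAutocorrelation A) :=
    integrable_weight_quarterCombs_add A integrable_weight
  have hν : Integrable weight (halfCombDiffraction A) :=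
    integrable_weight_quarterCombs_add A integrable_weight_dirac
  refine ⟨hasTemperateGrowth_of_integrable_weight hγ,
    hasTemperateGrowth_of_integrable_weight hν, ?_⟩
  ext g
  change ∫ x, 𝓕 g x ∂(halfCombAutocorrelation A) = ∫ x, g x ∂(halfCombDiffraction A)
  rw [halfCombAutocorrelation, halfCombDiffraction,
    (𝓕 g : 𝓢(Plane, ℂ)).hasDecay.integral_quarterCombs_add A integrable_weight,
    g.hasDecay.integral_quarterCombs_add A integrable_weight_dirac, tsum_intVec_fourier,
    tsum_isometry_fourier, integral_dirac]
  congr 2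
  -- Fourier inversion at the origin, `∫ 𝓕 g = g 0`, says that Lebesgue measure transforms to `δ₀`.
  have h : 𝓕⁻ (𝓕 g) (0 : Plane) = g 0 := by rw [FourierTransform.fourierInv_fourier_eq]
  rw [SchwartzMap.fourierInv_coe, Real.fourierInv_eq] at h
  simpa using h

/-! ### Arithmetic of generic rotations -/

lemma toEuclideanLin_apply_zero (R : Matrix (Fin 2) (Fin 2) ℝ) (x : Plane) :
    Matrix.toEuclideanLin R x 0 = R 0 0 * x 0 + R 0 1 * x 1 := by
  simp [Matrix.toEuclideanLin, Matrix.mulVec, dotProduct, Fin.sum_univ_two]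

lemma toEuclideanLin_apply_one (R : Matrix (Fin 2) (Fin 2) ℝ) (x : Plane) :
    Matrix.toEuclideanLin R x 1 = R 1 0 * x 0 + R 1 1 * x 1 := by
  simp [Matrix.toEuclideanLin, Matrix.mulVec, dotProduct, Fin.sum_univ_two]

lemma exists_linearIsometryEquiv_of_mem_specialOrthogonalGroup {R : Matrix (Fin 2) (Fin 2) ℝ}
    (hR : R ∈ Matrix.specialOrthogonalGroup (Fin 2) ℝ) :
    ∃ A : Plane ≃ₗᵢ[ℝ] Plane, ∀ x, A x = Matrix.toEuclideanLin R x := by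
  obtain ⟨h1, h2, h3⟩ := Matrix.mem_specialOrthogonalGroup_fin_two_iff.1 hR
  have hnorm : ∀ x : Plane, ‖Matrix.toEuclideanLin R x‖ = ‖x‖ := fun x => by
    rw [EuclideanSpace.norm_eq, EuclideanSpace.norm_eq]
    congr 1
    simp only [Fin.sum_univ_two, toEuclideanLin_apply_zero, toEuclideanLin_apply_one,
      Real.norm_eq_abs, sq_abs, ← h1]
    rw [h2] at h3 ⊢
    linear_combination (x 0 ^ 2 + x 1 ^ 2) * h3
  exact ⟨(⟨Matrix.toEuclideanLin R, hnorm⟩ : Plane →ₗᵢ[ℝ] Plane).toLinearIsometryEquiv rfl,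
    fun x => rfl⟩

lemma IsGenericRotation.exists_ne_intCast {R : Matrix (Fin 2) (Fin 2) ℝ}
    (hR : IsGenericRotation R) {k : Fin 2 → ℤ} (hk : k ≠ 0) :
    ∃ i, ∀ n : ℤ, Matrix.toEuclideanLin R (intVec k) i ≠ n := by
  by_contra! hcon
  obtain ⟨h1, h2, h3⟩ := Matrix.mem_specialOrthogonalGroup_fin_two_iff.1 hR.1
  obtain ⟨s, hs⟩ := hcon 0
  obtain ⟨t, ht⟩ := hcon 1
  rw [toEuclideanLin_apply_zero, intVec_apply, intVec_apply] at hs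
  rw [toEuclideanLin_apply_one, intVec_apply, intVec_apply, ← h1] at ht
  have hN : (k 0 ^ 2 + k 1 ^ 2 : ℚ) ≠ 0 := fun h => hk <| by
    have h' : k 0 ^ 2 + k 1 ^ 2 = 0 := by exact_mod_cast h
    ext i
    fin_cases i <;> simp <;> nlinarith
  have hN' : (k 0 ^ 2 + k 1 ^ 2 : ℝ) ≠ 0 := by exact_mod_cast hN
  -- In complex notation `a + ib = (s + it) / (k 0 + i k 1)`: one nonzero integer vector with
  -- integer image determines the rotation and makes its entries rational.
  set a : ℚ := (s * k 0 + t * k 1) / (k 0 ^ 2 + k 1 ^ 2) with ha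
  set b : ℚ := (t * k 0 - s * k 1) / (k 0 ^ 2 + k 1 ^ 2) with hb
  have ha' : R 0 0 = a := by
    rw [ha]
    push_cast
    rw [eq_div_iff hN', ← hs, ← ht, h2]
    ring
  have hb' : R 1 0 = b := by
    rw [hb]
    push_cast
    rw [eq_div_iff hN', ← hs, ← ht, h2]
    ring
  refine hR.2 ⟨!![a, -b; b, a], ?_, ?_⟩
  · rw [Matrix.of_mem_specialOrthogonalGroup_fin_two_iff]
    refine ⟨rfl, rfl, ?_⟩
    rw [h2, ha', hb'] at h3
    exact_mod_cast h3
  · ext i j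
    fin_cases i <;> fin_cases j <;> simp [← h1, h2, ha', hb']

/-! ### Weights on the union of the lattices -/

/-- Writing the mass as a sum over the whole plane lets combs on different sets be compared point by
point. -/
lemma weightedComb_apply (M : Set Plane) (I : Plane → ℝ≥0∞) {s : Set Plane}
    (hs : MeasurableSet s) :
    weightedComb M I s = ∑' x, M.indicator (fun x => I x * s.indicator 1 x) x := by
  rw [weightedComb, Measure.sum_apply _ hs, ← tsum_subtype M fun x => I x * s.indicator 1 x]
  simp [Measure.dirac_apply' _ hs]

lemma diracComb_eq_weightedComb (M : Set Plane) : diracComb M = weightedComb M fun _ => 1 := by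
  simp [diracComb, weightedComb]

lemma weightedComb_union_eq {M N : Set Plane} (h : M ∩ N = {0}) :
    (weightedComb (M ∪ N) fun x => if x = 0 then 1 else 1 / 4) =
      (1 / 4 : ℝ≥0∞) • diracComb M + (1 / 4 : ℝ≥0∞) • diracComb N +
        (1 / 2 : ℝ≥0∞) • Measure.dirac (0 : Plane) := by
  have hone : (1 / 4 + 1 / 4 + 1 / 2 : ℝ≥0∞) = 1 := by
    rw [← ENNReal.toReal_eq_toReal_iff' (by simp) (by simp)]
    simp [ENNReal.toReal_add]
    norm_num
  have h0 : (Measure.dirac (0 : Plane)) = weightedComb {0} fun _ => 1 := by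
    rw [← diracComb_eq_weightedComb, diracComb, Measure.sum_fintype]
    simp
  have hM : (0 : Plane) ∈ M := (h.ge rfl).1
  have hN : (0 : Plane) ∈ N := (h.ge rfl).2
  have hMN : ∀ x, x ∈ M → x ∈ N → x = 0 := fun x hxM hxN => h.le ⟨hxM, hxN⟩
  ext s hs
  rw [h0, diracComb_eq_weightedComb, diracComb_eq_weightedComb]
  simp only [Measure.add_apply, Measure.smul_apply, smul_eq_mul, weightedComb_apply _ _ hs,
    ← ENNReal.tsum_mul_left, ← ENNReal.tsum_add]
  refine tsum_congr fun x => ?_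
  by_cases hx : x = 0
  · subst hx
    simp only [Set.indicator, Set.mem_union, hM, hN, Set.mem_singleton, if_true, or_self,
      ← add_mul, hone, one_mul]
  · have := hMN x
    by_cases hxM : x ∈ M <;> by_cases hxN : x ∈ N <;> simp_all [Set.indicator]

end PlaneDiffraction

theorem mainTheorem4 (R : Matrix (Fin 2) (Fin 2) ℝ) (hR : IsGenericRotation R)
    (ω : Measure Plane)
    (hω : ω = (1 / 2 : ℝ≥0∞) • (diracComb squareLattice + diracComb (imageLattice R))) :
    squareLattice ∩ imageLattice R = {0} ∧
    IsAutocorrelation ω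
      ((1 / 4 : ℝ≥0∞) • diracComb squareLattice + (1 / 4 : ℝ≥0∞) • diracComb (imageLattice R) +
        (1 / 2 : ℝ≥0∞) • (volume : Measure Plane)) ∧
    IsDiffraction ω
      (weightedComb (squareLattice ∪ imageLattice R) fun x => if x = 0 then 1 else 1 / 4) := by
  obtain ⟨A, hAR⟩ := exists_linearIsometryEquiv_of_mem_specialOrthogonalGroup hR.1
  have hA : ∀ k ≠ 0, ∃ i, ∀ n : ℤ, A (intVec k) i ≠ n := fun k hk => by
    simpa only [hAR] using hR.exists_ne_intCast hk
  have himage : imageLattice R = Set.range fun n => A (intVec n) := by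
    simp only [imageLattice, ← range_intVec, ← Set.range_comp, hAR]
    rfl
  have hcombA : diracComb (imageLattice R) = isometryComb A := by
    rw [himage, diracComb_range (isometry_intVec_injective A), isometryComb]
  have hcomb : diracComb squareLattice = isometryComb (LinearIsometryEquiv.refl ℝ Plane) := by
    rw [← range_intVec, diracComb_range intVec_injective, isometryComb]
    rfl
  have hinter : squareLattice ∩ imageLattice R = {0} := by
    rw [himage]
    ext x
    constructor
    · rintro ⟨hx, k, rfl⟩
      by_contra h
      obtain ⟨i, hi⟩ := hA k fun hk => h (by simp [hk])
      obtain ⟨n, hn⟩ := hx i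
      exact hi n hn
    · rintro rfl
      exact ⟨fun i => ⟨0, by simp⟩, 0, by simp⟩
  rw [weightedComb_union_eq hinter, hω, hcombA, hcomb]
  have hauto := isAutocorrelation_halfComb hA
  exact ⟨hinter, hauto, _, hauto, isFourierTransform_halfCombAutocorrelation A⟩
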